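/- Call a set $D\subseteq[0,\infty)$ group-like if for every $\gamma\in D$ there is an additive subgroup $G$ of $\mathbb R$ with $D\cap[0,\gamma]=G\cap[0,\gamma]$ (for $D$ dense in $[0,\infty)$ this means $D=G\cap[0,\infty)$ for one additive subgroup $G$ of $\mathbb R$). A Bratteli diagram $B$ consists of finite vertex sets $V_n$ ($n\ge 0$), with $V_0$ a single vertex, and finite sets $E_n$ of edges from $V_n$ to $V_{n+1}$, such that every vertex is the source of an edge and every vertex outside $V_0$ is the range of an edge. Its $n$-th incidence matrix $F_n$ has as entry $(v,w)\in V_{n+1}\times V_n$ the number of edges from $w$ to $v$. $B$ has finite rank if the numbers $|V_n|$ are bounded. The path space $X_B$ is the set of infinite paths starting in $V_0$, with the topology generated by the cylinder sets. Two paths are tail equivalent ($\mathcal R$) if they agree from some level on. A Borel measure $\mu$ on $X_B$ is $\mathcal R$-invariant if every Borel automorphism of $X_B$ that maps each path to a tail equivalent one preserves $\mu$; it is ergodic if every Borel union of tail classes is null or conull. A Borel measure $\mu$ on a Cantor space $X$ with $\mu(X)=\infty$ is called non-defective if it is full (non-empty open sets have positive measure), non-atomic, and the set of points all of whose clopen neighbourhoods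 have infinite measure is $\mu$-null. For such $\mu$ put $S(\mu)=\{\mu(U): U\subseteq X \text{ clopen},\ \mu(U)<\infty\}$. The measure $\mu$ is good if for all clopen $U,V$ with $\mu(U)<\mu(V)$ there is a clopen $W\subseteq V$ with $\mu(W)=\mu(U)$. **Theorem.** Let $D\subseteq\mathbb Q\cap[0,\infty)$ be group-like and dense in $[0,\infty)$. Then there exist a Bratteli diagram $\widehat B$ of finite rank, whose path space is a Cantor space, and a good, infinite, non-defective, ergodic $\mathcal R$-invariant Borel measure $\widehat\mu$ on $X_{\widehat B}$ such that $S(\widehat\mu)=D$. Moreover, $\widehat B$ can be chosen with exactly two vertices on each level $n\ge 1$ and, for all $n\ge1$, with incidence matrix $$F_n=\begin{pmatrix}p_n&0\\ a_n&p_n\end{pmatrix}$$ for suitable integers $p_n\ge 2$, $a_n\ge 1$. -/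

import Mathlib

open Set MeasureTheory Topology
open scoped ENNReal

/-- A subset `D` of `[0, ∞)` is group-like if for every `γ ∈ D` there is an additive subgroup `G`
of `ℝ` such that `D ∩ [0, γ] = G ∩ [0, γ]`. -/
def IsGroupLike (D : Set ℝ) : Prop :=
  D ⊆ Ici 0 ∧ ∀ γ ∈ D, ∃ G : AddSubgroup ℝ, D ∩ Icc 0 γ = (G : Set ℝ) ∩ Icc 0 γ

/-- A Cantor space: a non-empty, compact, metrizable, totally disconnected space without isolated
points. -/
structure IsCantorSpace (X : Type*) [TopologicalSpace X] : Prop where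
  nonempty : Nonempty X
  compact : CompactSpace X
  metrizable : TopologicalSpace.MetrizableSpace X
  totallyDisconnected : TotallyDisconnectedSpace X
  perfect : PerfectSpace X

section Measures

variable {X : Type*} [TopologicalSpace X] [MeasurableSpace X]

/-- The defective set of `μ`: the points all of whose clopen neighbourhoods have infinite
measure. -/
def defectiveSet (μ : Measure X) : Set X :=
  {x | ∀ U : Set X, IsClopen U → x ∈ U → μ U = ∞}

/-- Non-defective measures: full non-atomic infinite Borel measures whose defective set is
null. -/
structure IsNonDefective (μ : Measure X) : Prop where
  infinite : μ univ = ∞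
  full : ∀ U : Set X, IsOpen U → U.Nonempty → 0 < μ U
  nonatomic : ∀ x : X, μ {x} = 0
  defective_null : μ (defectiveSet μ) = 0

/-- The clopen values set of `μ`: all finite values of `μ` on clopen sets. -/
def clopenValues (μ : Measure X) : Set ℝ :=
  {t | ∃ U : Set X, IsClopen U ∧ μ U < ∞ ∧ t = (μ U).toReal}

/-- A clopen set `V` is good for `μ` if for every clopen `U` with `μ U < μ V` there is a clopen
subset of `V` of the same measure as `U`. -/
def IsGoodSet (μ : Measure X) (V : Set X) : Prop :=
  ∀ U : Set X, IsClopen U → μ U < μ V → ∃ W : Set X, IsClopen W ∧ W ⊆ V ∧ μ W = μ U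

/-- A measure is good if every clopen set is good for it. -/
def IsGood (μ : Measure X) : Prop :=
  ∀ V : Set X, IsClopen V → IsGoodSet μ V

end Measures

/-- A Bratteli diagram: finite vertex sets `V n` with `V 0` a single point, and finite edge sets
`E n` of edges running from level `n` to level `n + 1`, such that every vertex is the source of an
edge and every vertex outside level `0` is the range of an edge. -/
structure BratteliDiagram where
  V : ℕ → Type
  E : ℕ → Type
  finite_V : ∀ n, Finite (V n)
  finite_E : ∀ n, Finite (E n)
  top : Nonempty (Unique (V 0))
  source : ∀ n, E n → V n
  range : ∀ n, E n → V (n + 1)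
  source_surjective : ∀ n, Function.Surjective (source n)
  range_surjective : ∀ n, Function.Surjective (range n)

namespace BratteliDiagram

variable (B : BratteliDiagram)

/-- The `n`-th incidence matrix: its `(v, w)` entry is the number of edges from `w` (level `n`) to
`v` (level `n + 1`). -/
noncomputable def incidence (n : ℕ) : Matrix (B.V (n + 1)) (B.V n) ℕ :=
  Matrix.of fun v w => Nat.card {e : B.E n // B.source n e = w ∧ B.range n e = v}

/-- The number of vertices on a level is bounded. -/
def FiniteRank : Prop :=
  ∃ k : ℕ, ∀ n, Nat.card (B.V n) ≤ k

/-- Every level other than the top one has two vertices, labelled `0` and `1`, such that the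
incidence matrices below level `1` are `[[p n, 0], [a n, p n]]`. -/
def HasTwoOdometerShape (p a : ℕ → ℕ) : Prop :=
  ∃ σ : ∀ n, B.V (n + 1) ≃ Fin 2, ∀ n,
    (B.incidence (n + 1)).reindex (σ (n + 1)) (σ n) = !![p n, 0; a n, p n]

/-- The space of infinite paths starting at the top vertex. -/
def PathSpace : Type :=
  {x : ∀ n, B.E n // ∀ n, B.range n (x n) = B.source (n + 1) (x (n + 1))}

instance (n : ℕ) : TopologicalSpace (B.E n) := ⊥

instance (n : ℕ) : DiscreteTopology (B.E n) := ⟨rfl⟩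

/-- The path space carries the topology of the product of the discrete spaces `E n`, that is, the
one generated by the cylinder sets. -/
instance : TopologicalSpace B.PathSpace :=
  inferInstanceAs (TopologicalSpace
    {x : ∀ n, B.E n // ∀ n, B.range n (x n) = B.source (n + 1) (x (n + 1))})

instance : MeasurableSpace B.PathSpace := borel _

instance : BorelSpace B.PathSpace := ⟨rfl⟩

variable {B}

/-- The tail (cofinal) equivalence relation on infinite paths. -/
def TailEquiv (x y : B.PathSpace) : Prop :=
  ∃ N : ℕ, ∀ n, N ≤ n → x.1 n = y.1 n

/-- `μ` is invariant under the tail equivalence relation: it is preserved by every Borel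
automorphism of the path space that moves each path within its tail class. -/
def IsTailInvariant (μ : Measure B.PathSpace) : Prop :=
  ∀ φ : B.PathSpace ≃ᵐ B.PathSpace, (∀ x, TailEquiv x (φ x)) → MeasurePreserving φ μ μ

/-- `μ` is ergodic for the tail equivalence relation: every Borel set that is a union of tail
classes is null or conull. -/
def IsTailErgodic (μ : Measure B.PathSpace) : Prop :=
  ∀ A : Set B.PathSpace, MeasurableSet A → (∀ x y, TailEquiv x y → x ∈ A → y ∈ A) →
    μ A = 0 ∨ μ Aᶜ = 0

end BratteliDiagram

/-! A dense group-like set `D` of rationals is an increasing union of sets of natural multiples of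
`g n`, where `g n` is a multiple of `g (n + 1)` by a factor at least 2
(`IsGroupLike.exists_divisor_sequence`). These factors are the bases of two odometers, one per
vertex, joined by edges from vertex 0 to vertex 1. With as many joining edges as digits, a path is a
digit sequence together with the level, possibly infinite, at which it switches to vertex 1.

The measure is `g 0` times counting measure on the finite switching levels times Haar measure on the
digits. A cylinder ending at vertex 1 fixes the switching level and has measure `g N`; one ending at
vertex 0 leaves infinitely many levels open and has infinite measure. Hence a clopen set of finite
measure is a finite disjoint union of cylinders of one measure `g N`. Selecting some of them gives
goodness, and every multiple of every `g n` occurs because the sets `reached q N` have finite but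
unbounded measure.

On paths that switch, tail equivalence ignores the switching level and changes finitely many digits.
Such changes are translations, whence invariance; Kolmogorov's zero-one law gives ergodicity. -/

/-! ### Divisibility in group-like sets of rationals -/

/-- Two positive rationals are multiples of a common positive rational, which is an integral
combination of them. -/
theorem Rat.exists_common_divisor (a b : ℚ) (ha : 0 < a) (hb : 0 < b) :
    ∃ g : ℚ, 0 < g ∧ (∃ m : ℕ, a = m * g) ∧ (∃ n : ℕ, b = n * g) ∧
      ∃ u v : ℤ, g = u * a + v * b := by
  have had : (a.den : ℚ) ≠ 0 := by exact_mod_cast a.den_ne_zero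
  have hbd : (b.den : ℚ) ≠ 0 := by exact_mod_cast b.den_ne_zero
  obtain ⟨A, hA⟩ := Int.eq_ofNat_of_zero_le (Rat.num_pos.2 ha).le
  obtain ⟨B, hB⟩ := Int.eq_ofNat_of_zero_le (Rat.num_pos.2 hb).le
  have hA0 : 0 < A := by have := Rat.num_pos.2 ha; omega
  have ha' : a * a.den = A := by rw [Rat.mul_den_eq_num, hA]; simp
  have hb' : b * b.den = B := by rw [Rat.mul_den_eq_num, hB]; simp
  set M := A * b.den with hM
  set N := B * a.den with hN
  have hg0 : 0 < Nat.gcd M N := Nat.gcd_pos_of_pos_left _ (Nat.mul_pos hA0 b.den_pos)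
  have hMa : (M : ℚ) = a * (a.den * b.den) := by rw [hM]; push_cast; rw [← ha']; ring
  have hNb : (N : ℚ) = b * (a.den * b.den) := by rw [hN]; push_cast; rw [← hb']; ring
  -- Over the common denominator `a.den * b.den` the numerators of `a` and `b` are `M` and `N`;
  -- Bézout gives the coefficients.
  refine ⟨Nat.gcd M N / (a.den * b.den), ?_, ?_, ?_, Nat.gcdA M N, Nat.gcdB M N, ?_⟩
  · have := a.den_pos
    have := b.den_pos
    positivity
  · obtain ⟨k, hk⟩ := Nat.gcd_dvd_left M N
    refine ⟨k, ?_⟩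
    have : (M : ℚ) = Nat.gcd M N * k := by exact_mod_cast hk
    field_simp
    linarith
  · obtain ⟨k, hk⟩ := Nat.gcd_dvd_right M N
    refine ⟨k, ?_⟩
    have : (N : ℚ) = Nat.gcd M N * k := by exact_mod_cast hk
    field_simp
    linarith
  · have : (Nat.gcd M N : ℚ) = M * Nat.gcdA M N + N * Nat.gcdB M N := by
      exact_mod_cast Nat.gcd_eq_gcd_ab M N
    rw [this, hMa, hNb]
    field_simp

namespace IsGroupLike

variable {D : Set ℝ}

theorem exists_gt (hdense : Ici 0 ⊆ closure D) (a : ℝ) : ∃ γ ∈ D, a < γ := by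
  have h : max a 0 + 1 ∈ closure D := hdense (by simp; positivity)
  obtain ⟨γ, h1, h2⟩ := mem_closure_iff.1 h (Ioi a) isOpen_Ioi
    (lt_of_le_of_lt (le_max_left a 0) (lt_add_one _))
  exact ⟨γ, h2, h1⟩

theorem exists_between (hdense : Ici 0 ⊆ closure D) {a : ℝ} (ha : 0 < a) :
    ∃ γ ∈ D, 0 < γ ∧ γ < a := by
  have h : a / 2 ∈ closure D := hdense (by simp; positivity)
  obtain ⟨γ, h1, h2⟩ := mem_closure_iff.1 h (Ioo 0 a) isOpen_Ioo ⟨by positivity, by linarith⟩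
  exact ⟨γ, h2, h1.1, h1.2⟩

/-- The subgroup depends on `γ`, so `a`, `b` and `g` must all lie below a single element of `D`. -/
theorem mem_of_combination (h : IsGroupLike D) {γ a b g : ℝ} (hγ : γ ∈ D) (ha : a ∈ D) (hb : b ∈ D)
    (haγ : a ≤ γ) (hbγ : b ≤ γ) (hg : g ∈ Icc 0 γ) (u v : ℤ) (huv : g = u * a + v * b) :
    g ∈ D := by
  obtain ⟨G, hG⟩ := h.2 γ hγ
  have h1 : ∀ x ∈ D, x ≤ γ → x ∈ G := fun x hx hxγ =>
    ((Set.ext_iff.1 hG x).1 ⟨hx, h.1 hx, hxγ⟩).1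
  refine ((Set.ext_iff.1 hG g).2 ⟨?_, hg⟩).1
  rw [huv, ← zsmul_eq_mul, ← zsmul_eq_mul]
  exact G.add_mem (G.zsmul_mem (h1 a ha haγ) u) (G.zsmul_mem (h1 b hb hbγ) v)

theorem natCast_mul_mem (h : IsGroupLike D) (hdense : Ici 0 ⊆ closure D) {g : ℝ} (hg : g ∈ D)
    (k : ℕ) : k * g ∈ D := by
  obtain ⟨γ, hγ, hlt⟩ := exists_gt hdense (max g (k * g))
  have h0 : 0 ≤ g := h.1 hg
  exact h.mem_of_combination hγ hg hg ((le_max_left _ _).trans hlt.le)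
    ((le_max_left _ _).trans hlt.le) ⟨by positivity, (le_max_right _ _).trans hlt.le⟩ k 0 (by simp)

theorem exists_common_divisor (h : IsGroupLike D) (hrat : D ⊆ range ((↑) : ℚ → ℝ))
    {a b : ℝ} (ha : a ∈ D) (hb : b ∈ D) (ha0 : 0 < a) (hb0 : 0 < b) :
    ∃ g ∈ D, 0 < g ∧ (∃ m : ℕ, a = m * g) ∧ ∃ n : ℕ, b = n * g := by
  obtain ⟨a, rfl⟩ := hrat ha
  obtain ⟨b, rfl⟩ := hrat hb
  obtain ⟨g, hg, ⟨m, hm⟩, ⟨n, hn⟩, u, v, huv⟩ := Rat.exists_common_divisor a b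
    (by exact_mod_cast ha0) (by exact_mod_cast hb0)
  have hm' : (a : ℝ) = m * g := by exact_mod_cast hm
  have hn' : (b : ℝ) = n * g := by exact_mod_cast hn
  have hg' : (0 : ℝ) < g := by exact_mod_cast hg
  have hga : (g : ℝ) ≤ a := by
    have : m ≠ 0 := by rintro rfl; simp at hm'; simp [hm'] at ha0
    have : (1 : ℝ) ≤ m := by exact_mod_cast Nat.one_le_iff_ne_zero.2 this
    rw [hm']; nlinarith
  refine ⟨g, ?_, hg', ⟨m, hm'⟩, n, hn'⟩
  have huv' : (g : ℝ) = u * a + v * b := by exact_mod_cast huv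
  rcases le_total (a : ℝ) b with hab | hab
  · exact h.mem_of_combination hb ha hb hab le_rfl ⟨hg'.le, hga.trans hab⟩ u v huv'
  · exact h.mem_of_combination ha ha hb le_rfl hab ⟨hg'.le, hga⟩ u v huv'

/-- The inductive step for the divisor sequence: the new divisor absorbs one prescribed element `d`,
and the form `q + 2` guarantees at least two digits. -/
theorem exists_refinement (h : IsGroupLike D) (hrat : D ⊆ range ((↑) : ℚ → ℝ))
    (hdense : Ici 0 ⊆ closure D) {a d : ℝ} (ha : a ∈ D) (ha0 : 0 < a) (hd : d ∈ D) :
    ∃ g ∈ D, 0 < g ∧ (∃ q : ℕ, a = ((q + 2 : ℕ) : ℝ) * g) ∧ ∃ m : ℕ, d = m * g := by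
  obtain ⟨g, hg, hg0, ⟨m, hm⟩, n, hn⟩ :
      ∃ g ∈ D, 0 < g ∧ (∃ m : ℕ, a = m * g) ∧ ∃ n : ℕ, d = n * g := by
    rcases (show (0 : ℝ) ≤ d from h.1 hd).eq_or_lt with hd0 | hd0
    · exact ⟨a, ha, ha0, ⟨1, by simp⟩, 0, by simp [← hd0]⟩
    · exact h.exists_common_divisor hrat ha hd ha0 hd0
  -- A common divisor `g'` of `g` and a smaller `δ` gives `g = k * g'` with `k > l ≥ 1`, which
  -- secures a factor at least 2.
  obtain ⟨δ, hδ, hδ0, hδg⟩ := exists_between hdense hg0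
  obtain ⟨g', hg', hg0', ⟨k, hk⟩, l, hl⟩ := h.exists_common_divisor hrat hg hδ hg0 hδ0
  have hl0 : l ≠ 0 := by rintro rfl; simp at hl; simp [hl] at hδ0
  have hlk : (l : ℝ) < k := by
    rw [hk, hl] at hδg
    exact lt_of_mul_lt_mul_right hδg hg0'.le
  have hlk' : l < k := by exact_mod_cast hlk
  have hm0 : m ≠ 0 := by rintro rfl; simp at hm; simp [hm] at ha0
  refine ⟨g', hg', hg0', ⟨m * k - 2, ?_⟩, n * k, ?_⟩
  · have : 2 ≤ m * k := by
      calc 2 ≤ 1 * k := by omega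
        _ ≤ m * k := Nat.mul_le_mul_right _ (Nat.one_le_iff_ne_zero.2 hm0)
    rw [Nat.sub_add_cancel this, hm, hk]
    push_cast
    ring
  · rw [hn, hk]
    push_cast
    ring

/-- A dense group-like set of rationals consists of the multiples of the terms of a sequence each
of whose terms is a proper multiple of the next. -/
theorem exists_divisor_sequence (h : IsGroupLike D) (hrat : D ⊆ range ((↑) : ℚ → ℝ))
    (hdense : Ici 0 ⊆ closure D) :
    ∃ (q : ℕ → ℕ) (g : ℕ → ℝ), 0 < g 0 ∧ (∀ n, g n = ((q n + 2 : ℕ) : ℝ) * g (n + 1)) ∧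
      ∀ t, t ∈ D ↔ ∃ n k : ℕ, t = k * g n := by
  obtain ⟨γ, hγ, hγ0⟩ := exists_gt hdense 0
  have hc : D.Countable := (countable_range ((↑) : ℚ → ℝ)).mono hrat
  obtain ⟨d, hd⟩ := hc.exists_eq_range ⟨γ, hγ⟩
  have step : ∀ (a : {a : ℝ // a ∈ D ∧ 0 < a}) (n : ℕ), ∃ b : {a : ℝ // a ∈ D ∧ 0 < a},
      (∃ q : ℕ, a.1 = ((q + 2 : ℕ) : ℝ) * b.1) ∧ ∃ m : ℕ, d n = m * b.1 := by
    intro a n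
    obtain ⟨g, hg, hg0, h1, h2⟩ := h.exists_refinement hrat hdense a.2.1 a.2.2
      (hd ▸ mem_range_self n : d n ∈ D)
    exact ⟨⟨g, hg, hg0⟩, h1, h2⟩
  choose f hf1 hf2 using step
  -- Term `n + 1` divides both term `n` and `d n`, so each element of the enumeration `d` of `D` is
  -- eventually a multiple.
  let s : ℕ → {a : ℝ // a ∈ D ∧ 0 < a} := fun n => Nat.rec ⟨γ, hγ, hγ0⟩ (fun n a => f a n) n
  choose q hq using fun n => hf1 (s n) n
  refine ⟨q, fun n => (s n).1, (s 0).2.2, fun n => ?_, fun t => ⟨fun ht => ?_, ?_⟩⟩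
  · exact hq n
  · rw [hd] at ht
    obtain ⟨n, rfl⟩ := ht
    obtain ⟨m, hm⟩ := hf2 (s n) n
    exact ⟨n + 1, m, hm⟩
  · rintro ⟨n, k, rfl⟩
    exact h.natCast_mul_mem hdense (s n).2.1 k

end IsGroupLike

/-! ### Digit sequences and their Haar measure -/

/-- The digit sequences of the odometer with bases `q n + 2`. -/
abbrev Digits (q : ℕ → ℕ) : Type := ∀ n, Fin (q n + 2)

namespace Digits

open ProbabilityTheory

variable {q : ℕ → ℕ}

/-- The product of the uniform measures on the digits. -/
noncomputable def haar (q : ℕ → ℕ) : Measure (Digits q) :=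
  Measure.infinitePi fun n => uniformOn (univ : Set (Fin (q n + 2)))

instance : IsProbabilityMeasure (haar q) := by
  unfold haar; infer_instance

/-- The digit sequences with the same first `N` digits as `y`. -/
def cyl (N : ℕ) (y : Digits q) : Set (Digits q) := {z | ∀ i < N, z i = y i}

theorem cyl_eq_pi (N : ℕ) (y : Digits q) :
    cyl N y = Set.pi (Finset.range N : Set ℕ) fun i => {y i} := by
  ext z; simp [cyl]

theorem haar_cyl (N : ℕ) (y : Digits q) :
    haar q (cyl N y) = ∏ i ∈ Finset.range N, ((q i + 2 : ℕ) : ℝ≥0∞)⁻¹ := by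
  rw [cyl_eq_pi, haar, Measure.infinitePi_pi _ fun _ _ => measurableSet_singleton _]
  refine Finset.prod_congr rfl fun i _ => ?_
  rw [uniformOn_univ]
  simp

theorem haar_singleton (y : Digits q) : haar q {y} = 0 := by
  have h : ∀ N, haar q {y} ≤ (2⁻¹ : ℝ≥0∞) ^ N := fun N =>
    calc haar q {y} ≤ haar q (cyl N y) := measure_mono (by rintro _ rfl i _; rfl)
      _ = ∏ i ∈ Finset.range N, ((q i + 2 : ℕ) : ℝ≥0∞)⁻¹ := haar_cyl N y
      _ ≤ ∏ i ∈ Finset.range N, 2⁻¹ := by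
          refine Finset.prod_le_prod' fun i _ => ENNReal.inv_le_inv.2 ?_
          push_cast
          exact le_add_self
      _ = _ := by simp
  refine le_antisymm (ge_of_tendsto' (ENNReal.tendsto_pow_atTop_nhds_zero_of_lt_one ?_) h)
    zero_le
  simp

/-- Addition is digitwise modulo `q n + 2`, without carries, so it preserves each uniform factor. -/
theorem measurePreserving_add_right (c : Digits q) :
    MeasurePreserving (fun y : Digits q => y + c) (haar q) (haar q) := by
  refine ⟨measurable_pi_lambda _ fun n =>
    (measurable_of_finite (fun a : Fin (q n + 2) => a + c n)).comp (measurable_pi_apply n), ?_⟩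
  have h := Measure.infinitePi_map_pi (fun n => uniformOn (univ : Set (Fin (q n + 2))))
    (f := fun n a => a + c n) fun n => measurable_of_finite _
  refine h.trans (congrArg Measure.infinitePi (funext fun n => ?_))
  ext s -
  rw [Measure.map_apply (measurable_of_finite _) s.toFinite.measurableSet, uniformOn_univ,
    uniformOn_univ]
  congr 1
  rw [← Measure.count_injective_image (add_left_injective (c n))]
  congr 1
  exact image_preimage_eq _ (add_right_surjective (c n))

/-- A measurable set of digit sequences that is closed under changing finitely many digits has
measure zero or one. -/
theorem haar_eq_zero_or_one {A : Set (Digits q)} (hA : MeasurableSet A)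
    (hinv : ∀ y z : Digits q, (∃ N, ∀ n, N ≤ n → y n = z n) → y ∈ A → z ∈ A) :
    haar q A = 0 ∨ haar q A = 1 := by
  let s : ℕ → MeasurableSpace (Digits q) := fun n =>
    MeasurableSpace.comap (fun y : Digits q => y n) inferInstance
  have hind : iIndep s (haar q) :=
    iIndepFun_infinitePi (P := fun n => uniformOn (univ : Set (Fin (q n + 2))))
      (X := fun n y => y) fun n => measurable_id
  refine measure_zero_or_one_of_measurableSet_limsup_atTop (s := s)
    (fun n => (measurable_pi_apply n).comap_le) hind ?_
  rw [Filter.limsup_eq_iInf_iSup_of_nat]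
  refine (MeasurableSpace.measurableSet_iInf).2 fun N => ?_
  -- `r` erases the first `N` digits. It is measurable for the later digits and `A = r ⁻¹' A`, so
  -- `A` is a tail event.
  let r : Digits q → Digits q := fun y n => if N ≤ n then y n else 0
  have hr : Measurable[⨆ n, ⨆ (_ : n ≥ N), s n] r := by
    refine @measurable_pi_lambda _ _ _ (_) _ _ fun n => ?_
    by_cases hn : N ≤ n
    · simp only [r, if_pos hn]
      exact (Measurable.of_comap_le le_rfl : Measurable[s n] fun y : Digits q => y n).mono
        (le_iSup₂_of_le n hn le_rfl) le_rfl
    · simp only [r, if_neg hn]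
      exact measurable_const
  have : A = r ⁻¹' A := by
    ext y
    have hy : ∀ n, N ≤ n → y n = r y n := fun n hn => by simp [r, hn]
    exact ⟨hinv _ _ ⟨N, hy⟩, hinv _ _ ⟨N, fun n hn => (hy n hn).symm⟩⟩
  rw [this]
  exact hr hA

end Digits

/-! ### The diagram and coordinates on its paths -/

/-- The vertices of the two-odometer diagram. -/
def TwoOdometerVertex : ℕ → Type
  | 0 => Unit
  | _ + 1 => Fin 2

/-- The edges of the two-odometer diagram: below level one an edge consists of its source, its
range and a digit. -/
def TwoOdometerEdge (q : ℕ → ℕ) : ℕ → Type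
  | 0 => Fin 2
  | n + 1 => {st : Fin 2 × Fin 2 // st.1 ≤ st.2} × Fin (q n + 2)

/-- The diagram with incidence matrices `[[q n + 2, 0], [q n + 2, q n + 2]]`. -/
def twoOdometer (q : ℕ → ℕ) : BratteliDiagram where
  V := TwoOdometerVertex
  E := TwoOdometerEdge q
  finite_V
    | 0 => inferInstanceAs (Finite Unit)
    | _ + 1 => inferInstanceAs (Finite (Fin 2))
  finite_E
    | 0 => inferInstanceAs (Finite (Fin 2))
    | n + 1 => inferInstanceAs (Finite ({st : Fin 2 × Fin 2 // st.1 ≤ st.2} × Fin (q n + 2)))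
  top := ⟨inferInstanceAs (Unique Unit)⟩
  source
    | 0 => fun _ => ()
    | _ + 1 => fun e => e.1.1.1
  range
    | 0 => fun e => e
    | _ + 1 => fun e => e.1.1.2
  source_surjective
    | 0 => fun _ => ⟨(0 : Fin 2), rfl⟩
    | _ + 1 => fun v => ⟨(⟨(v, v), le_rfl⟩, 0), rfl⟩
  range_surjective
    | 0 => fun v => ⟨v, rfl⟩
    | _ + 1 => fun v => ⟨(⟨(v, v), le_rfl⟩, 0), rfl⟩

namespace twoOdometer

variable {q : ℕ → ℕ}

theorem card_edges (n : ℕ) (v w : Fin 2) :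
    Nat.card {e : {st : Fin 2 × Fin 2 // st.1 ≤ st.2} × Fin (q n + 2) //
      e.1.1.1 = w ∧ e.1.1.2 = v} = if w ≤ v then q n + 2 else 0 := by
  split_ifs with h
  · refine (Nat.card_congr (β := Fin (q n + 2)) ⟨fun e => e.1.2,
      fun d => ⟨(⟨(w, v), h⟩, d), rfl, rfl⟩, ?_, fun _ => rfl⟩).trans (Nat.card_fin _)
    rintro ⟨⟨⟨⟨a, b⟩, hab⟩, d⟩, rfl, rfl⟩
    rfl
  · have : IsEmpty {e : {st : Fin 2 × Fin 2 // st.1 ≤ st.2} × Fin (q n + 2) //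
        e.1.1.1 = w ∧ e.1.1.2 = v} :=
      ⟨fun e => h (by have := e.1.1.2; rwa [e.2.1, e.2.2] at this)⟩
    exact Nat.card_of_isEmpty

theorem hasTwoOdometerShape (q : ℕ → ℕ) :
    (twoOdometer q).HasTwoOdometerShape (fun n => q n + 2) (fun n => q n + 2) := by
  refine ⟨fun n => Equiv.refl (Fin 2), fun n => ?_⟩
  ext v w
  refine (card_edges n v w).trans ?_
  fin_cases v <;> fin_cases w <;> simp

theorem finiteRank (q : ℕ → ℕ) : (twoOdometer q).FiniteRank := by
  refine ⟨2, fun n => ?_⟩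
  cases n with
  | zero => exact (Nat.card_unique (α := Unit)).trans_le (by norm_num)
  | succ n => exact (Nat.card_fin 2).le

/-- The vertex of a path on level `n + 1`. -/
def state (x : (twoOdometer q).PathSpace) (n : ℕ) : Fin 2 :=
  (twoOdometer q).source (n + 1) (x.1 (n + 1))

/-- The digit of the edge of a path between levels `n + 1` and `n + 2`. -/
def digit (x : (twoOdometer q).PathSpace) : Digits q := fun n =>
  Prod.snd (α := {st : Fin 2 × Fin 2 // st.1 ≤ st.2}) (x.1 (n + 1))

theorem edge_zero (x : (twoOdometer q).PathSpace) : x.1 0 = state x 0 := x.2 0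

theorem edge_succ (x : (twoOdometer q).PathSpace) (n : ℕ) :
    ∃ h : state x n ≤ state x (n + 1), x.1 (n + 1) =
      ((⟨(state x n, state x (n + 1)), h⟩, digit x n) :
        {st : Fin 2 × Fin 2 // st.1 ≤ st.2} × Fin (q n + 2)) := by
  have h := x.2 (n + 1)
  change _ = state x (n + 1) at h
  rw [← h]
  exact ⟨Subtype.prop (Prod.fst (β := Fin (q n + 2)) (x.1 (n + 1))), rfl⟩

theorem state_mono (x : (twoOdometer q).PathSpace) : Monotone (state x) :=
  monotone_nat_of_le_succ fun n => (edge_succ x n).1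

/-- Two paths have the same edges up to level `N + 1` if and only if they have the same states and
digits up to there. -/
theorem edges_eq_iff {x y : (twoOdometer q).PathSpace} {N : ℕ} :
    (∀ i ≤ N, x.1 i = y.1 i) ↔
      (∀ i ≤ N, state x i = state y i) ∧ ∀ i < N, digit x i = digit y i := by
  constructor
  · refine fun h => ⟨fun i hi => ?_, fun i hi => ?_⟩
    · cases i with
      | zero => exact (edge_zero x).symm.trans ((h 0 hi).trans (edge_zero y))
      | succ i =>
        exact (x.2 (i + 1)).symm.trans ((congrArg _ (h (i + 1) hi)).trans (y.2 (i + 1)))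
    · exact congrArg (Prod.snd (α := {st : Fin 2 × Fin 2 // st.1 ≤ st.2})) (h (i + 1) hi)
  · rintro ⟨hs, hd⟩ i hi
    cases i with
    | zero => exact (edge_zero x).trans ((hs 0 hi).trans (edge_zero y).symm)
    | succ i =>
      obtain ⟨h1, h2⟩ := edge_succ x i
      obtain ⟨h3, h4⟩ := edge_succ y i
      rw [h2, h4]
      simp only [hs i (by omega), hs (i + 1) hi, hd i (by omega)]
      rfl

theorem path_ext {x y : (twoOdometer q).PathSpace} (hs : state x = state y)
    (hd : digit x = digit y) : x = y :=
  Subtype.ext <| funext fun i => edges_eq_iff.2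
    ⟨fun j _ => congrFun hs j, fun j _ => congrFun hd j⟩ i le_rfl

/-- The path with given digits that is at vertex `1` exactly from level `k + 1` on. -/
def ofSwitch (k : ℕ) (y : Digits q) : (twoOdometer q).PathSpace :=
  ⟨fun n => match n with
    | 0 => (if k ≤ 0 then 1 else 0 : Fin 2)
    | n + 1 => ((⟨(if k ≤ n then 1 else 0, if k ≤ n + 1 then 1 else 0), by
        split_ifs <;> first | omega | decide⟩, y n) :
        {st : Fin 2 × Fin 2 // st.1 ≤ st.2} × Fin (q n + 2)), fun n => match n with
    | 0 => rfl
    | _ + 1 => rfl⟩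

theorem state_ofSwitch (k : ℕ) (y : Digits q) (n : ℕ) :
    state (ofSwitch k y) n = if k ≤ n then 1 else 0 := rfl

theorem digit_ofSwitch (k : ℕ) (y : Digits q) : digit (ofSwitch k y) = y := rfl

theorem exists_eq_ofSwitch {x : (twoOdometer q).PathSpace} {n : ℕ} (h : state x n = 1) :
    ∃ k ≤ n, x = ofSwitch k (digit x) := by
  classical
  have hex : ∃ n, state x n = 1 := ⟨n, h⟩
  refine ⟨Nat.find hex, Nat.find_min' hex h, path_ext (funext fun m => ?_) rfl⟩
  rw [state_ofSwitch]
  split_ifs with hm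
  · have := (Nat.find_spec hex).symm.trans_le (state_mono x hm)
    omega
  · have := Nat.find_min hex (not_le.1 hm)
    omega

theorem ofSwitch_injective {k l : ℕ} {y z : Digits q} (h : ofSwitch k y = ofSwitch l z) :
    k = l ∧ y = z := by
  refine ⟨?_, congrArg digit h⟩
  have h1 := congrArg (state · k) h
  have h2 := congrArg (state · l) h
  simp only [state_ofSwitch, le_refl, if_true] at h1 h2
  split_ifs at h1 h2 <;> omega

/-- Past both switching levels the two paths stay at vertex 1, so only digits matter. -/
theorem tailEquiv_ofSwitch {k l : ℕ} {y z : Digits q} {N : ℕ} (h : ∀ n, N ≤ n → y n = z n) :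
    BratteliDiagram.TailEquiv (ofSwitch k y) (ofSwitch l z) := by
  refine ⟨max N (max k l) + 1, fun n hn => ?_⟩
  obtain ⟨n, rfl⟩ : ∃ m, n = m + 1 := ⟨n - 1, by omega⟩
  obtain ⟨h1, h2⟩ := edge_succ (ofSwitch k y) n
  obtain ⟨h3, h4⟩ := edge_succ (ofSwitch l z) n
  rw [h2, h4]
  simp only [state_ofSwitch, digit_ofSwitch, if_pos (show k ≤ n by omega),
    if_pos (show l ≤ n by omega), if_pos (show k ≤ n + 1 by omega),
    if_pos (show l ≤ n + 1 by omega), h n (by omega)]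
  rfl

theorem exists_of_tailEquiv {k : ℕ} {y : Digits q} {x : (twoOdometer q).PathSpace}
    (h : BratteliDiagram.TailEquiv (ofSwitch k y) x) :
    ∃ l z, x = ofSwitch l z ∧ ∃ N, ∀ n, N ≤ n → y n = z n := by
  obtain ⟨N, hN⟩ := h
  have h1 : state x (max N k) = 1 := by
    have := congrArg ((twoOdometer q).source _) (hN (max N k + 1) (by omega))
    change state (ofSwitch k y) _ = state x _ at this
    rw [← this, state_ofSwitch, if_pos (le_max_right _ _)]
  obtain ⟨l, -, hl⟩ := exists_eq_ofSwitch h1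
  exact ⟨l, digit x, hl, N, fun n hn =>
    congrArg (Prod.snd (α := {st : Fin 2 × Fin 2 // st.1 ≤ st.2})) (hN (n + 1) (by omega))⟩

theorem continuous_ofSwitch (k : ℕ) : Continuous (ofSwitch k : Digits q → _) := by
  refine Continuous.subtype_mk (continuous_pi fun n => ?_) _
  cases n with
  | zero => exact continuous_const
  | succ n =>
    exact (continuous_of_discreteTopology (f := fun d : Fin (q n + 2) =>
      (show (twoOdometer q).E (n + 1) from ((⟨(if k ≤ n then 1 else 0, if k ≤ n + 1 then 1 else 0), by
        split_ifs <;> first | omega | decide⟩, d) :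
        {st : Fin 2 × Fin 2 // st.1 ≤ st.2} × Fin (q n + 2))))).comp (continuous_apply n)

end twoOdometer

/-! ### Topology of path spaces and cylinders -/

namespace BratteliDiagram

variable {B : BratteliDiagram}

instance (n : ℕ) : Finite (B.E n) := B.finite_E n

theorem continuous_edge (n : ℕ) : Continuous fun x : B.PathSpace => x.1 n :=
  (continuous_apply n).comp continuous_subtype_val

theorem isClosedEmbedding_val :
    IsClosedEmbedding (fun x : B.PathSpace => (x.1 : ∀ n, B.E n)) := by
  refine ⟨IsEmbedding.subtypeVal, ?_⟩
  have : Set.range (fun x : B.PathSpace => (x.1 : ∀ n, B.E n)) =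
      ⋂ n, {x | B.range n (x n) = B.source (n + 1) (x (n + 1))} := by
    ext x
    simp only [mem_range, mem_iInter, mem_ofPred_eq]
    exact ⟨fun ⟨y, hy⟩ => hy ▸ y.2, fun hx => ⟨⟨x, hx⟩, rfl⟩⟩
  rw [this]
  let t : ∀ n, TopologicalSpace (B.V n) := fun _ => ⊥
  have ht : ∀ n, DiscreteTopology (B.V n) := fun _ => ⟨rfl⟩
  exact isClosed_iInter fun n => isClosed_eq
    (continuous_of_discreteTopology.comp (continuous_apply n))
    (continuous_of_discreteTopology.comp (continuous_apply (n + 1)))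

instance : TopologicalSpace.MetrizableSpace B.PathSpace :=
  isClosedEmbedding_val.isEmbedding.metrizableSpace

instance : SecondCountableTopology B.PathSpace :=
  isClosedEmbedding_val.isEmbedding.secondCountableTopology

instance : TotallyDisconnectedSpace B.PathSpace :=
  ⟨isClosedEmbedding_val.isEmbedding.isTotallyDisconnected
    (isTotallyDisconnected_of_totallyDisconnectedSpace _)⟩

instance : CompactSpace B.PathSpace :=
  isClosedEmbedding_val.compactSpace

/-- The paths with the same first `N + 1` edges as `x`. -/
def cyl (N : ℕ) (x : B.PathSpace) : Set B.PathSpace := {y | ∀ i ≤ N, y.1 i = x.1 i}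

theorem isClopen_cyl (N : ℕ) (x : B.PathSpace) : IsClopen (cyl N x) := by
  have : cyl N x = ⋂ i ∈ Set.Iic N, (fun y : B.PathSpace => y.1 i) ⁻¹' {x.1 i} := by
    ext y; simp [cyl]
  rw [this]
  exact (finite_Iic N).isClopen_biInter fun i _ => (isClopen_discrete _).preimage (continuous_edge i)

theorem exists_cyl_subset {U : Set B.PathSpace} (hU : IsOpen U) {x : B.PathSpace} (hx : x ∈ U) :
    ∃ N, cyl N x ⊆ U := by
  obtain ⟨O, hO, rfl⟩ := isOpen_induced_iff.1 hU
  obtain ⟨v, ⟨z, n, rfl⟩, hxv, hv⟩ :=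
    (PiNat.isTopologicalBasis_cylinders B.E).exists_subset_of_mem_open hx hO
  rw [← PiNat.mem_cylinder_iff_eq.1 hxv] at hv
  exact ⟨n, fun y hy => hv fun i hi => hy i hi.le⟩

/-- `U` is a union of cylinders given by the first `N + 1` edges. -/
def IsLevel (N : ℕ) (U : Set B.PathSpace) : Prop := ∀ x ∈ U, cyl N x ⊆ U

theorem IsLevel.mono {N M : ℕ} (h : N ≤ M) {U : Set B.PathSpace} (hU : IsLevel N U) :
    IsLevel M U := fun x hx _ hy => hU x hx fun i hi => hy i (hi.trans h)

theorem exists_isLevel {U : Set B.PathSpace} (hU : IsClopen U) : ∃ N, IsLevel N U := by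
  -- The sets `{x | cyl N x ⊆ U}` are open, increase with `N` and cover the compact set `U`.
  obtain ⟨N, hN⟩ := hU.isClosed.isCompact.elim_directed_cover (fun N => {x | cyl N x ⊆ U})
    (fun N => isOpen_iff_forall_mem_open.2 fun x hx => ⟨cyl N x, fun y hy z hz =>
      hx fun i hi => (hz i hi).trans (hy i hi), (isClopen_cyl N x).isOpen, fun _ _ => rfl⟩)
    (fun x hx => mem_iUnion.2 (exists_cyl_subset hU.isOpen hx))
    (directed_of_isDirected_le fun N M h x hx y hy => hx fun i hi => hy i (hi.trans h))
  exact ⟨N, fun x hx => hN hx⟩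

end BratteliDiagram

namespace BratteliDiagram

variable {B : BratteliDiagram}

theorem IsLevel.isOpen {N : ℕ} {U : Set B.PathSpace} (hU : IsLevel N U) : IsOpen U :=
  isOpen_iff_forall_mem_open.2 fun x hx => ⟨cyl N x, hU x hx, (isClopen_cyl N x).isOpen,
    fun _ _ => rfl⟩

theorem IsLevel.isClopen {N : ℕ} {U : Set B.PathSpace} (hU : IsLevel N U) : IsClopen U := by
  refine ⟨⟨IsLevel.isOpen (N := N) fun x hx y hy hyU => hx (hU y hyU fun i hi => ?_)⟩, hU.isOpen⟩
  exact (hy i hi).symm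

theorem IsLevel.inter {N : ℕ} {U V : Set B.PathSpace} (hU : IsLevel N U) (hV : IsLevel N V) :
    IsLevel N (U ∩ V) := fun x hx => subset_inter (hU x hx.1) (hV x hx.2)

theorem cyl_eq_of_mem {N : ℕ} {x y : B.PathSpace} (h : y ∈ cyl N x) : cyl N y = cyl N x := by
  ext z
  exact forall₂_congr fun i hi => by rw [h i hi]

theorem mem_cyl_self (N : ℕ) (x : B.PathSpace) : x ∈ cyl N x := fun _ _ => rfl

theorem finite_range_cyl (N : ℕ) : (Set.range (cyl N : B.PathSpace → Set B.PathSpace)).Finite := by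
  refine (Set.finite_range fun e : ∀ i : Fin (N + 1), B.E i =>
    {y : B.PathSpace | ∀ i : Fin (N + 1), y.1 i = e i}).subset ?_
  rintro _ ⟨x, rfl⟩
  refine ⟨fun i => x.1 i, ?_⟩
  ext y
  exact ⟨fun h i hi => h ⟨i, by omega⟩, fun h i => h i (by omega)⟩

/-- If the cylinders in a level set have the same measure then the measures of its level subsets
are exactly the multiples of that measure. -/
theorem IsLevel.exists_subset_measure_eq {N : ℕ} {V : Set B.PathSpace} (hV : IsLevel N V)
    {μ : Measure B.PathSpace} {w : ℝ≥0∞} (hw : ∀ x ∈ V, μ (cyl N x) = w) :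
    ∃ m : ℕ, μ V = m * w ∧ ∀ j ≤ m, ∃ W ⊆ V, IsClopen W ∧ μ W = j * w := by
  classical
  have hfin : (cyl N '' V).Finite := (finite_range_cyl N).subset (image_subset_range _ _)
  have key : ∀ T ⊆ hfin.toFinset, μ (⋃ s ∈ T, s) = T.card * w ∧ IsClopen (⋃ s ∈ T, s) ∧
      ⋃ s ∈ T, s ⊆ V := by
    intro T hT
    have hT' : ∀ s ∈ T, ∃ x ∈ V, cyl N x = s := fun s hs => by simpa using hT hs
    refine ⟨?_, ?_, ?_⟩
    · rw [measure_biUnion_finset]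
      · rw [Finset.sum_congr rfl (g := fun _ => w), Finset.sum_const, nsmul_eq_mul]
        intro s hs
        obtain ⟨x, hx, rfl⟩ := hT' s hs
        exact hw x hx
      · intro s hs t ht hst
        obtain ⟨x, hx, rfl⟩ := hT' s hs
        obtain ⟨y, hy, rfl⟩ := hT' t ht
        refine Set.disjoint_left.2 fun z hzx hzy => hst ?_
        exact (cyl_eq_of_mem hzx).symm.trans (cyl_eq_of_mem hzy)
      · intro s hs
        obtain ⟨x, hx, rfl⟩ := hT' s hs
        exact (isClopen_cyl N x).isOpen.measurableSet
    · refine T.finite_toSet.isClopen_biUnion fun s hs => ?_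
      obtain ⟨x, hx, rfl⟩ := hT' s hs
      exact isClopen_cyl N x
    · refine iUnion₂_subset fun s hs => ?_
      obtain ⟨x, hx, rfl⟩ := hT' s hs
      exact hV x hx
  refine ⟨hfin.toFinset.card, ?_, fun j hj => ?_⟩
  · rw [← (key _ subset_rfl).1]
    congr 1
    refine subset_antisymm (fun x hx => ?_) (key _ subset_rfl).2.2
    exact mem_iUnion₂.2 ⟨cyl N x, by simpa using ⟨x, hx, rfl⟩, mem_cyl_self N x⟩
  · obtain ⟨T, hT, rfl⟩ := Finset.exists_subset_card_eq hj
    exact ⟨_, (key T hT).2.2, (key T hT).2.1, (key T hT).1⟩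

end BratteliDiagram

/-! ### The measure: cylinders, goodness, clopen values -/

namespace twoOdometer

open BratteliDiagram

variable {q : ℕ → ℕ} {c : ℝ≥0∞}

/-- The measure that is `c` times the product measure on the paths with a given switching level, and
zero on the paths that never reach vertex `1`. -/
noncomputable def measure (q : ℕ → ℕ) (c : ℝ≥0∞) : Measure (twoOdometer q).PathSpace :=
  c • Measure.sum fun k => (Digits.haar q).map (ofSwitch k)

theorem measurable_ofSwitch (k : ℕ) :
    Measurable (ofSwitch k : Digits q → (twoOdometer q).PathSpace) :=
  (continuous_ofSwitch k).measurable

theorem measure_apply {A : Set (twoOdometer q).PathSpace} (hA : MeasurableSet A) :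
    measure q c A = c * ∑' k, Digits.haar q (ofSwitch k ⁻¹' A) := by
  rw [measure, Measure.smul_apply, Measure.sum_apply _ hA, smul_eq_mul]
  congr 2
  ext k
  exact Measure.map_apply (measurable_ofSwitch k) hA

/-- The common measure of the cylinders ending at vertex `1` on level `N + 1`. -/
noncomputable def weight (q : ℕ → ℕ) (c : ℝ≥0∞) (N : ℕ) : ℝ≥0∞ :=
  c * ∏ i ∈ Finset.range N, ((q i + 2 : ℕ) : ℝ≥0∞)⁻¹

theorem weight_succ (N : ℕ) : weight q c N = (q N + 2 : ℕ) * weight q c (N + 1) := by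
  rw [weight, weight, Finset.prod_range_succ, mul_left_comm, mul_left_comm _ _ (_⁻¹),
    ENNReal.mul_inv_cancel (by simp) (ENNReal.natCast_ne_top _), mul_one]

theorem weight_ne_zero (hc : c ≠ 0) (N : ℕ) : weight q c N ≠ 0 :=
  mul_ne_zero hc (Finset.prod_ne_zero_iff.2 fun _ _ =>
    ENNReal.inv_ne_zero.2 (ENNReal.natCast_ne_top _))

theorem weight_ne_top (hc : c ≠ ∞) (N : ℕ) : weight q c N ≠ ∞ :=
  ENNReal.mul_ne_top hc (ENNReal.prod_ne_top fun _ _ => ENNReal.inv_ne_top.2 (by simp))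

theorem weight_eq_natCast_mul {n N : ℕ} (h : n ≤ N) :
    ∃ m : ℕ, weight q c n = m * weight q c N := by
  induction N, h using Nat.le_induction with
  | base => exact ⟨1, by simp⟩
  | succ N _ ih =>
    obtain ⟨m, hm⟩ := ih
    exact ⟨m * (q N + 2), by rw [hm, weight_succ N]; push_cast; ring⟩

/-- The cylinder records the switching level `k ≤ N`, so a single summand survives, and it is a
digit cylinder. -/
theorem measure_cyl_of_state_eq_one {N : ℕ} {x : (twoOdometer q).PathSpace} (hx : state x N = 1) :
    measure q c (cyl N x) = weight q c N := by
  obtain ⟨k, hk, hxk⟩ := exists_eq_ofSwitch hx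
  rw [measure_apply (isClopen_cyl N x).isOpen.measurableSet, tsum_eq_single k, weight,
    ← Digits.haar_cyl N (digit x)]
  · congr 2
    ext y
    refine edges_eq_iff.trans ?_
    rw [digit_ofSwitch]
    refine and_iff_right fun i hi => ?_
    rw [hxk, state_ofSwitch, state_ofSwitch]
  · intro l hl
    convert measure_empty (μ := Digits.haar q)
    refine eq_empty_iff_forall_notMem.2 fun y hy => hl ?_
    have hs := (edges_eq_iff.1 hy).1
    rw [hxk] at hs
    have h1 := hs k hk
    have h2 := hs N le_rfl
    simp only [state_ofSwitch, le_refl, if_true, if_pos hk] at h1 h2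
    have hlk : l ≤ k := by by_contra h; simp [h] at h1
    have h3 := hs l (hlk.trans hk)
    simp only [state_ofSwitch, le_refl, if_true] at h3
    by_contra hne
    rw [if_neg (by omega)] at h3
    exact absurd h3 (by decide)

/-- Every switching level above `N` is still possible, and each contributes the same positive mass.
-/
theorem measure_cyl_of_state_eq_zero (hc : c ≠ 0) {N : ℕ} {x : (twoOdometer q).PathSpace}
    (hx : state x N = 0) : measure q c (cyl N x) = ∞ := by
  rw [measure_apply (isClopen_cyl N x).isOpen.measurableSet]
  refine ENNReal.mul_eq_top.2 (Or.inl ⟨hc, top_unique ?_⟩)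
  calc (∞ : ℝ≥0∞) = ∑' _ : ℕ, Digits.haar q (Digits.cyl N (digit x)) := by
        refine (ENNReal.tsum_const_eq_top_of_ne_zero ?_).symm
        rw [Digits.haar_cyl]
        exact Finset.prod_ne_zero_iff.2 fun _ _ => ENNReal.inv_ne_zero.2 (ENNReal.natCast_ne_top _)
    _ = ∑' k : ℕ, Digits.haar q (ofSwitch (k + (N + 1)) ⁻¹' cyl N x) := by
        refine tsum_congr fun k => ?_
        congr 1
        ext y
        refine Iff.trans ?_ edges_eq_iff.symm
        rw [digit_ofSwitch]
        refine (and_iff_right fun i hi => ?_).symm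
        rw [state_ofSwitch, if_neg (by omega)]
        have := (state_mono x hi).trans_eq hx
        omega
    _ ≤ _ := ENNReal.tsum_comp_le_tsum_of_injective (add_left_injective (N + 1))
        fun k => Digits.haar q (ofSwitch k ⁻¹' cyl N x)

/-- The paths that are at vertex `1` on level `N + 1`. -/
def reached (q : ℕ → ℕ) (N : ℕ) : Set (twoOdometer q).PathSpace := {x | state x N = 1}

theorem isLevel_reached (N : ℕ) : IsLevel N (reached q N) := fun x hx y hy => by
  have := (edges_eq_iff.1 hy).1 N le_rfl
  exact this.trans hx

theorem monotone_reached : Monotone (reached q) := fun N M h x (hx : state x N = 1) => by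
  have := hx.symm.trans_le (state_mono x h)
  change state x M = 1
  omega

theorem measure_reached (N : ℕ) : measure q c (reached q N) = c * (N + 1 : ℕ) := by
  rw [measure_apply (isLevel_reached N).isOpen.measurableSet,
    tsum_eq_sum (s := Finset.range (N + 1))]
  · congr 1
    rw [Finset.sum_congr rfl (g := fun _ => 1)]
    · simp
    · intro k hk
      have : ofSwitch k ⁻¹' reached q N = univ := eq_univ_of_forall fun y => by
        exact if_pos (Nat.lt_succ_iff.1 (Finset.mem_range.1 hk))
      rw [this, measure_univ]
  · intro k hk
    have : ofSwitch k ⁻¹' reached q N = ∅ := eq_empty_iff_forall_notMem.2 fun y hy => by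
      have h : (if k ≤ N then 1 else 0 : Fin 2) = 1 := hy
      rw [if_neg (by simpa using hk)] at h
      exact absurd h (by decide)
    rw [this, measure_empty]

theorem measure_compl_iUnion_reached : measure q c (⋃ N, reached q N)ᶜ = 0 := by
  rw [measure_apply (isOpen_iUnion fun N => (isLevel_reached N).isOpen).measurableSet.compl]
  refine mul_eq_zero_of_right _ (ENNReal.tsum_eq_zero.2 fun k => ?_)
  convert measure_empty (μ := Digits.haar q)
  refine eq_empty_iff_forall_notMem.2 fun y hy => hy (mem_iUnion.2 ⟨k, ?_⟩)
  exact if_pos le_rfl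

/-- Needed for goodness of clopen sets of infinite measure, which must be cut down to a finite part
first. -/
theorem measure_eq_iSup_inter_reached (A : Set (twoOdometer q).PathSpace) :
    measure q c A = ⨆ N, measure q c (A ∩ reached q N) := by
  have hmono : Monotone fun N => A ∩ reached q N := fun N M h =>
    inter_subset_inter_right _ (monotone_reached h)
  rw [← hmono.measure_iUnion, ← inter_iUnion]
  refine le_antisymm ?_ (measure_mono inter_subset_left)
  calc measure q c A ≤ measure q c (A ∩ ⋃ N, reached q N) + measure q c (A \ ⋃ N, reached q N) :=
        measure_le_inter_add_sdiff _ _ _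
    _ = _ := by
        have h : A \ ⋃ N, reached q N ⊆ (⋃ N, reached q N)ᶜ := fun x hx => hx.2
        rw [measure_mono_null h measure_compl_iUnion_reached, add_zero]

theorem state_eq_one_of_measure_lt_top (hc : c ≠ 0) {N : ℕ} {V : Set (twoOdometer q).PathSpace}
    (hV : IsLevel N V) (hfin : measure q c V < ∞) {x : (twoOdometer q).PathSpace} (hx : x ∈ V) :
    state x N = 1 := by
  by_contra h
  have := measure_cyl_of_state_eq_zero (c := c) hc (N := N) (x := x) (by omega)
  exact absurd ((measure_mono (hV x hx)).trans_lt hfin) (by rw [this]; exact lt_irrefl _)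

theorem exists_subset_measure_eq (hc : c ≠ 0) {N : ℕ} {V : Set (twoOdometer q).PathSpace}
    (hV : IsLevel N V) (hfin : measure q c V < ∞) :
    ∃ m : ℕ, measure q c V = m * weight q c N ∧
      ∀ j ≤ m, ∃ W ⊆ V, IsClopen W ∧ measure q c W = j * weight q c N :=
  hV.exists_subset_measure_eq fun _ hx =>
    measure_cyl_of_state_eq_one (state_eq_one_of_measure_lt_top hc hV hfin hx)

theorem measure_reached_lt_top (hc : c ≠ ∞) (N : ℕ) : measure q c (reached q N) < ∞ := by
  rw [measure_reached]
  exact (ENNReal.mul_ne_top hc (ENNReal.natCast_ne_top _)).lt_top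

theorem weight_mul_le_iff (hc : c ≠ 0) (hc' : c ≠ ∞) {N j m : ℕ} :
    j * weight q c N ≤ m * weight q c N ↔ j ≤ m := by
  rw [ENNReal.mul_le_mul_iff_left (weight_ne_zero hc N) (weight_ne_top hc' N), Nat.cast_le]

/-- At a common level, `U` and a finite part of `V` consist of `i` and `j` cylinders of equal weight
with `i ≤ j`. -/
theorem isGood_measure (hc : c ≠ 0) (hc' : c ≠ ∞) : IsGood (measure q c) := by
  intro V hV U hU hlt
  rw [measure_eq_iSup_inter_reached V, lt_iSup_iff] at hlt
  obtain ⟨N, hN⟩ := hlt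
  obtain ⟨n, hn⟩ := exists_isLevel hU
  obtain ⟨m, hm⟩ := exists_isLevel hV
  have hV' := (hm.mono (le_max_left m N)).inter ((isLevel_reached (q := q) N).mono (le_max_right m N))
  obtain ⟨i, hi, -⟩ := exists_subset_measure_eq hc (hn.mono (le_max_left n (max m N)))
    (hN.trans_le le_top)
  obtain ⟨j, hj, hsub⟩ := exists_subset_measure_eq hc (hV'.mono (le_max_right n (max m N)))
    ((measure_mono inter_subset_right).trans_lt (measure_reached_lt_top hc' N))
  rw [hi, hj] at hN
  obtain ⟨W, hW, hWc, hWm⟩ := hsub i ((weight_mul_le_iff hc hc').1 hN.le)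
  exact ⟨W, hWc, hW.trans inter_subset_left, hWm.trans hi.symm⟩

theorem clopenValues_measure (hc : c ≠ 0) (hc' : c ≠ ∞) :
    clopenValues (measure q c) = {t | ∃ n k : ℕ, t = k * (weight q c n).toReal} := by
  ext t
  constructor
  · rintro ⟨U, hU, hfin, rfl⟩
    obtain ⟨n, hn⟩ := exists_isLevel hU
    obtain ⟨k, hk, -⟩ := exists_subset_measure_eq hc hn hfin
    exact ⟨n, k, by rw [hk, ENNReal.toReal_mul, ENNReal.toReal_natCast]⟩
  · rintro ⟨n, k, rfl⟩
    obtain ⟨N, hN⟩ : ∃ N : ℕ, k * weight q c n ≤ c * (N + 1 : ℕ) := by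
      -- Since `weight q c n ≤ c`, the value `k * weight q c n` is at most the measure `c * (k + 1)`
      -- of `reached q k`.
      refine ⟨k, ?_⟩
      have h1 : weight q c n ≤ c := mul_le_of_le_one_right' (Finset.prod_le_one' fun i _ =>
        ENNReal.inv_le_one.2 (by exact_mod_cast (show 1 ≤ q i + 2 by omega)))
      rw [mul_comm]
      exact mul_le_mul' h1 (by exact_mod_cast k.le_succ)
    obtain ⟨l, hl⟩ := weight_eq_natCast_mul (q := q) (c := c) (le_max_left n N)
    obtain ⟨m, hm, hsub⟩ := exists_subset_measure_eq hc
      ((isLevel_reached (q := q) N).mono (le_max_right n N)) (measure_reached_lt_top hc' N)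
    have hkl : (k : ℝ≥0∞) * weight q c n = (k * l : ℕ) * weight q c (max n N) := by
      rw [hl]; push_cast; ring
    rw [← measure_reached, hm, hkl, weight_mul_le_iff hc hc'] at hN
    obtain ⟨W, -, hW, hWm⟩ := hsub _ hN
    rw [← hkl] at hWm
    refine ⟨W, hW, ?_, ?_⟩
    · rw [hWm]
      exact (ENNReal.mul_ne_top (ENNReal.natCast_ne_top _) (weight_ne_top hc' _)).lt_top
    · rw [hWm, ENNReal.toReal_mul, ENNReal.toReal_natCast]

theorem isNonDefective_measure (hc : c ≠ 0) (hc' : c ≠ ∞) : IsNonDefective (measure q c) where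
  infinite := by
    rw [measure_apply MeasurableSet.univ]
    simp only [preimage_univ, measure_univ]
    rw [ENNReal.tsum_const_eq_top_of_ne_zero one_ne_zero, ENNReal.mul_top hc]
  full := by
    rintro U hU ⟨x, hx⟩
    obtain ⟨N, hN⟩ := exists_cyl_subset hU hx
    refine lt_of_lt_of_le (pos_iff_ne_zero.2 ?_) (measure_mono hN)
    by_cases h : state x N = 1
    · rw [measure_cyl_of_state_eq_one h]
      exact weight_ne_zero hc N
    · rw [measure_cyl_of_state_eq_zero hc (by omega)]
      exact ENNReal.top_ne_zero
  nonatomic x := by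
    rw [measure_apply (measurableSet_singleton x)]
    refine mul_eq_zero_of_right _ (ENNReal.tsum_eq_zero.2 fun k => ?_)
    refine measure_mono_null (fun y hy => ?_) (Digits.haar_singleton (digit x))
    exact congrArg digit hy
  defective_null := by
    refine measure_mono_null (t := (⋃ N, reached q N)ᶜ) (fun x hx => ?_)
      measure_compl_iUnion_reached
    refine mem_compl fun hx' => ?_
    obtain ⟨N, hN⟩ := mem_iUnion.1 hx'
    exact (measure_reached_lt_top hc' N).ne (hx _ (isLevel_reached N).isClopen hN)

theorem isCantorSpace (q : ℕ → ℕ) : IsCantorSpace (twoOdometer q).PathSpace where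
  nonempty := ⟨ofSwitch 0 0⟩
  compact := inferInstance
  metrizable := inferInstance
  totallyDisconnected := inferInstance
  perfect := by
    -- An open singleton contradicts a full non-atomic measure; any scale works, here `c = 1`.
    refine perfectSpace_iff_forall_not_isolated.2 fun x => ⟨fun h => ?_⟩
    have hμ := isNonDefective_measure (q := q) one_ne_zero ENNReal.one_ne_top
    exact (hμ.full {x} (isOpen_singleton_iff_punctured_nhds x |>.2 h) ⟨x, rfl⟩).ne'
      (hμ.nonatomic x)

/-! ### Tail invariance and ergodicity -/

/-- Finitely supported translations form a countable group, which makes the decomposition behind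
invariance countable. -/
theorem exists_eq_add {y z : Digits q} (h : ∃ N, ∀ n, N ≤ n → y n = z n) :
    ∃ γ : Π₀ n, Fin (q n + 2), z = y + γ := by
  obtain ⟨N, hN⟩ := h
  refine ⟨DFinsupp.mk (Finset.range N) fun i => z i - y i, ?_⟩
  ext1 n
  by_cases hn : n < N
  · simp [hn]
  · simp [hn, hN n (not_lt.1 hn)]

/-- On paths that switch, `φ` splits into countably many pieces, each replacing the switching level
`k` by `l` and translating the digits by some `γ`; each piece preserves Haar measure. -/
theorem isTailInvariant_measure : IsTailInvariant (measure q c) := by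
  intro φ hφ
  refine ⟨φ.measurable, ?_⟩
  ext A hA
  rw [Measure.map_apply φ.measurable hA, measure_apply (φ.measurable hA), measure_apply hA]
  congr 1
  -- The pieces are indexed by their images: `z` is the image's digit sequence and `z - γ` the
  -- source's.
  let R : ℕ → ℕ → (Π₀ n, Fin (q n + 2)) → Set (Digits q) := fun k l γ =>
    {z | φ (ofSwitch k (z - γ)) = ofSwitch l z}
  have hR : ∀ k l γ, MeasurableSet (R k l γ) := fun k l γ =>
    measurableSet_eq_fun (φ.measurable.comp ((measurable_ofSwitch k).comp
      (by
        simp only [sub_eq_add_neg]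
        exact (Digits.measurePreserving_add_right _).measurable))) (measurable_ofSwitch l)
  have hadd : ∀ γ : Π₀ n, Fin (q n + 2), Measurable fun y : Digits q => y + γ := fun γ =>
    (Digits.measurePreserving_add_right _).measurable
  have h1 : ∀ k, Digits.haar q (ofSwitch k ⁻¹' (φ ⁻¹' A)) =
      ∑' l, ∑' γ, Digits.haar q (R k l γ ∩ ofSwitch l ⁻¹' A) := by
    intro k
    rw [← ENNReal.tsum_prod (f := fun l γ => Digits.haar q (R k l γ ∩ ofSwitch l ⁻¹' A))]
    have : ofSwitch k ⁻¹' (φ ⁻¹' A) = ⋃ i : ℕ × Π₀ n, Fin (q n + 2),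
        (fun y : Digits q => y + i.2) ⁻¹' (R k i.1 i.2 ∩ ofSwitch i.1 ⁻¹' A) := by
      ext y
      simp only [mem_preimage, mem_iUnion, mem_inter_iff, R, mem_ofPred_eq, add_sub_cancel_right]
      constructor
      · intro h
        obtain ⟨l, z, hlz, hN⟩ := exists_of_tailEquiv (hφ (ofSwitch k y))
        obtain ⟨γ, rfl⟩ := exists_eq_add hN
        exact ⟨(l, γ), hlz, hlz ▸ h⟩
      · rintro ⟨i, hi, h⟩
        rwa [hi]
    rw [this, measure_iUnion]
    · refine tsum_congr fun i => ?_
      exact (Digits.measurePreserving_add_right _).measure_preimage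
        ((hR _ _ _).inter (measurable_ofSwitch _ hA)).nullMeasurableSet
    · intro i j hij
      refine Set.disjoint_left.2 fun y hi hj => hij ?_
      simp only [mem_preimage, mem_inter_iff, R, mem_ofPred_eq, add_sub_cancel_right] at hi hj
      obtain ⟨h1, h2⟩ := ofSwitch_injective (hi.1.symm.trans hj.1)
      exact Prod.ext h1 (DFunLike.coe_injective (add_left_cancel h2))
    · exact fun i => hadd _ ((hR _ _ _).inter (measurable_ofSwitch _ hA))
  -- For a fixed target level, surjectivity of `φ` makes the pieces cover and injectivity makes them
  -- disjoint.
  have h2 : ∀ l, Digits.haar q (ofSwitch l ⁻¹' A) =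
      ∑' k, ∑' γ, Digits.haar q (R k l γ ∩ ofSwitch l ⁻¹' A) := by
    intro l
    rw [← ENNReal.tsum_prod (f := fun k γ => Digits.haar q (R k l γ ∩ ofSwitch l ⁻¹' A))]
    have : ofSwitch l ⁻¹' A = ⋃ i : ℕ × Π₀ n, Fin (q n + 2),
        (R i.1 l i.2 ∩ ofSwitch l ⁻¹' A) := by
      ext z
      simp only [mem_preimage, mem_iUnion, mem_inter_iff, R, mem_ofPred_eq, exists_and_right]
      refine (and_iff_right ?_).symm
      have h := hφ (φ.symm (ofSwitch l z))
      rw [φ.apply_symm_apply] at h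
      obtain ⟨N, hN⟩ := h
      obtain ⟨k, y, hky, N, hN⟩ := exists_of_tailEquiv
        ⟨N, fun n hn => (hN n hn).symm⟩
      obtain ⟨γ, rfl⟩ := exists_eq_add ⟨N, fun n hn => (hN n hn).symm⟩
      refine ⟨(k, γ), ?_⟩
      rw [add_sub_cancel_right, ← hky, φ.apply_symm_apply]
    rw [this, measure_iUnion]
    · simp only [← this]
    · intro i j hij
      refine Set.disjoint_left.2 fun y hi hj => hij ?_
      simp only [mem_inter_iff, R, mem_ofPred_eq] at hi hj
      obtain ⟨h1, h2⟩ := ofSwitch_injective (φ.injective (hi.1.trans hj.1.symm))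
      exact Prod.ext h1 (DFunLike.coe_injective (sub_right_injective h2))
    · exact fun i => (hR _ _ _).inter (measurable_ofSwitch _ hA)
  simp_rw [h1, h2]
  exact ENNReal.tsum_comm

/-- All slices `ofSwitch k ⁻¹' A` coincide, and the common slice obeys the zero-one law. -/
theorem isTailErgodic_measure : IsTailErgodic (measure q c) := by
  intro A hA hinv
  have hpre : ∀ k, (ofSwitch k ⁻¹' A : Set (Digits q)) = ofSwitch 0 ⁻¹' A := fun k => by
    ext y
    exact ⟨hinv _ _ (tailEquiv_ofSwitch (N := 0) fun _ _ => rfl),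
      hinv _ _ (tailEquiv_ofSwitch (N := 0) fun _ _ => rfl)⟩
  have h01 := Digits.haar_eq_zero_or_one (measurable_ofSwitch 0 hA) fun y z ⟨N, hN⟩ hy =>
    hinv _ _ (tailEquiv_ofSwitch hN) hy
  rw [measure_apply hA, measure_apply hA.compl]
  simp only [preimage_compl, hpre]
  refine h01.imp (fun h => by simp [h]) fun h => ?_
  rw [(prob_compl_eq_zero_iff (measurable_ofSwitch 0 hA)).2 h]
  simp

end twoOdometer

theorem mainTheorem12 (D : Set ℝ)
    (hrat : D ⊆ Set.range ((↑) : ℚ → ℝ) ∩ Set.Ici 0)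
    (hdense : Set.Ici 0 ⊆ closure D)
    (hgroup : IsGroupLike D) :
    ∃ (B : BratteliDiagram) (p a : ℕ → ℕ) (μ : Measure B.PathSpace),
      B.FiniteRank ∧
      (∀ n, 2 ≤ p n ∧ 1 ≤ a n) ∧ B.HasTwoOdometerShape p a ∧
      IsCantorSpace B.PathSpace ∧
      IsNonDefective μ ∧
      BratteliDiagram.IsTailInvariant μ ∧ BratteliDiagram.IsTailErgodic μ ∧
      IsGood μ ∧
      clopenValues μ = D := by
  obtain ⟨q, g, hg0, hg, hD⟩ :=
    hgroup.exists_divisor_sequence (hrat.trans inter_subset_left) hdense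
  have hc : ENNReal.ofReal (g 0) ≠ 0 := by simpa using hg0
  have hc' : ENNReal.ofReal (g 0) ≠ ∞ := ENNReal.ofReal_ne_top
  -- With `c = g 0` the weights satisfy the same recursion as `g`.
  have hw : ∀ n, (twoOdometer.weight q (ENNReal.ofReal (g 0)) n).toReal = g n := by
    intro n
    induction n with
    | zero => simp [twoOdometer.weight, hg0.le]
    | succ n ih =>
      rw [twoOdometer.weight_succ, hg n, ENNReal.toReal_mul, ENNReal.toReal_natCast] at ih
      exact mul_left_cancel₀ (by positivity) ih
  refine ⟨twoOdometer q, fun n => q n + 2, fun n => q n + 2,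
    twoOdometer.measure q (ENNReal.ofReal (g 0)), twoOdometer.finiteRank q,
    fun n => ⟨Nat.le_add_left 2 _, Nat.succ_le_succ (Nat.zero_le _)⟩,
    twoOdometer.hasTwoOdometerShape q, twoOdometer.isCantorSpace q,
    twoOdometer.isNonDefective_measure hc hc', twoOdometer.isTailInvariant_measure,
    twoOdometer.isTailErgodic_measure, twoOdometer.isGood_measure hc hc', ?_⟩
  rw [twoOdometer.clopenValues_measure hc hc']
  ext t
  simp only [hw, hD, mem_ofPred_eq]
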